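/- All graphs are finite and simple. An orientation $D$ of a graph $G$ replaces each edge of $G$ by exactly one of the two possible arcs with the same ends; $d_D^-(v)$ is the number of arcs of $D$ with head $v$. The orientation is proper if $d_D^-(u)\neq d_D^-(v)$ for every edge $uv$ of $G$, and the proper orientation number $\overrightarrow{\chi}(G)$ is the least integer $n$ such that $G$ has a proper orientation $D$ with $d_D^-(v)\le n$ for every vertex $v$. A block of $G$ is a maximal connected subgraph of $G$ that has no cut-vertex of its own. $G$ is a block graph if each of its blocks is a complete graph, and a block graph $G$ is $k$-uniform if each of its blocks has exactly $k=\omega(G)$ vertices, where $\omega(G)$ is the maximum size of a clique of $G$. Theorem. Let $k\ge 1$ be an integer and let $G$ be a $k$-uniform block graph. Then $$\overrightarrow{\chi}(G)\le 3k-2 .$$ -/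

import Mathlib

namespace SimpleGraph

variable {V : Type*}

/-- `D` is an orientation of `G`: every edge of `G` is replaced by exactly one of the two
possible arcs with the same ends, and `D` has no other arcs. `D.Adj u v` is the arc from `u`
to `v`, with head `v`. -/
def IsOrientation (G : SimpleGraph V) (D : Digraph V) : Prop :=
  (∀ u v, G.Adj u v ↔ D.Adj u v ∨ D.Adj v u) ∧ ∀ u v, ¬ (D.Adj u v ∧ D.Adj v u)

/-- The indegree of `v` in `D`: the number of arcs with head `v` (used on finite vertex types). -/
noncomputable def digraphInDegree (D : Digraph V) (v : V) : ℕ :=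
  {u | D.Adj u v}.ncard

/-- `D` is a proper orientation of `G`: adjacent vertices have different indegrees. -/
def IsProperOrientation (G : SimpleGraph V) (D : Digraph V) : Prop :=
  G.IsOrientation D ∧ ∀ u v, G.Adj u v → digraphInDegree D u ≠ digraphInDegree D v

/-- `G` admits a proper `n`-orientation: a proper orientation with maximum indegree at most `n`. -/
def HasProperOrientation (G : SimpleGraph V) (n : ℕ) : Prop :=
  ∃ D : Digraph V, G.IsProperOrientation D ∧ ∀ v, digraphInDegree D v ≤ n

/-- The proper orientation number: the least `n` such that `G` admits a proper `n`-orientation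
(it would be `⊤` if there were no such `n`, so a finite upper bound asserts existence). -/
noncomputable def properOrientationNumber (G : SimpleGraph V) : ℕ∞ :=
  ⨅ n ∈ {n : ℕ | G.HasProperOrientation n}, (n : ℕ∞)

/-- The vertex set `s` induces a nonseparable subgraph of `G`: a (nonempty) connected graph
which has no cut-vertex. Single vertices and edges qualify. -/
def IsNonseparableSet (G : SimpleGraph V) (s : Set V) : Prop :=
  (G.induce s).Connected ∧ ∀ v ∈ s, (G.induce (s \ {v})).Preconnected

/-- The blocks of `G`, that is, its maximal nonseparable subgraphs. By maximality
these are induced subgraphs, so they are represented by their vertex sets. -/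
def IsBlock (G : SimpleGraph V) (s : Set V) : Prop :=
  Maximal G.IsNonseparableSet s

/-- A block graph: every block is a complete graph. -/
def IsBlockGraph (G : SimpleGraph V) : Prop :=
  ∀ s, G.IsBlock s → G.IsClique s

/-- A `k`-uniform block graph: a block graph in which every block has exactly `k = ω(G)`
vertices. -/
def IsUniformBlockGraph (G : SimpleGraph V) (k : ℕ) : Prop :=
  G.IsBlockGraph ∧ k = G.cliqueNum ∧ ∀ s, G.IsBlock s → s.ncard = k

end SimpleGraph

namespace SimpleGraph

/-! ### Connectivity in block graphs -/

section

variable {V : Type*}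

/-! Root every component and measure depth by distance to the root. In a uniform block graph every
block is then one parent together with k - 1 siblings one level deeper
(`IsUniformBlockGraph.isBlockForest`), so the graph can be oriented block by block from the bottom
up. Siblings are ordered transitively; the first t of them send their arc to the parent and the
others receive it, so within the block they receive e = 0, ..., t - 1, t + 1, ..., k - 1 arcs.

The induction records which final indegrees d a vertex can reach from each e. Its invariant is that
(0, 0) is reachable, which serves the roots, and that the vertex is flexible or saturable. A class
of siblings may be all flexible, without flexible vertices, or mixed; three lemmas say which d and t
of the parent each kind tolerates. Flexible siblings start with the distinct colours d = e and are
repaired one at a time by `exists_recolor`.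

In `isFlexible_or_isSaturable` the parent either keeps d = e, or for each e ≥ 1 reaches k
consecutive values of d, one of which escapes any k - 1 forbidden colours, or is saturable. The
highest interval used is 2k - 1, ..., 3k - 2; this gives the bound. -/

theorem Walk.reachable_induce {G : SimpleGraph V} {u v : V} (p : G.Walk u v) {s : Set V}
    (hs : ∀ w ∈ p.support, w ∈ s) :
    (G.induce s).Reachable ⟨u, hs u p.start_mem_support⟩ ⟨v, hs v p.end_mem_support⟩ :=
  ⟨p.induce s hs⟩

theorem IsClique.preconnected_induce {G : SimpleGraph V} {s : Set V} (hs : G.IsClique s) :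
    (G.induce s).Preconnected := by
  rintro ⟨a, ha⟩ ⟨b, hb⟩
  by_cases h : a = b
  · subst h; rfl
  · exact Adj.reachable (by simpa using hs ha hb h)

theorem IsClique.isNonseparableSet {G : SimpleGraph V} {s : Set V} (hs : G.IsClique s)
    (hne : s.Nonempty) : G.IsNonseparableSet s := by
  refine ⟨?_, fun v _ => (hs.subset Set.sdiff_subset).preconnected_induce⟩
  have := hne.to_subtype
  exact ⟨hs.preconnected_induce⟩

/-- A path together with a further vertex joined to both of its ends is nonseparable. -/
theorem Walk.IsPath.isNonseparableSet_insert {G : SimpleGraph V} {u v x : V} {p : G.Walk u v}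
    (hp : p.IsPath) (hx : x ∉ p.support) (hu : G.Adj x u) (hv : G.Adj x v) :
    G.IsNonseparableSet (insert x {w | w ∈ p.support}) := by
  classical
  have key : ∀ s : Set V, ∀ hxs : x ∈ s, (∀ y : s, (G.induce s).Reachable y ⟨x, hxs⟩) →
      (G.induce s).Preconnected := fun s hxs h a b => (h a).trans (h b).symm
  have toU : ∀ s : Set V, ∀ hxs : x ∈ s, ∀ y (hy : y ∈ p.support) (hys : y ∈ s),
      (∀ w ∈ (p.takeUntil y hy).support, w ∈ s) →
      (G.induce s).Reachable ⟨y, hys⟩ ⟨x, hxs⟩ := by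
    intro s hxs y hy hys h
    refine (Walk.reachable_induce _ h).symm.trans (Adj.reachable ?_)
    simpa using hu.symm
  have toV : ∀ s : Set V, ∀ hxs : x ∈ s, ∀ y (hy : y ∈ p.support) (hys : y ∈ s),
      (∀ w ∈ (p.dropUntil y hy).support, w ∈ s) →
      (G.induce s).Reachable ⟨y, hys⟩ ⟨x, hxs⟩ := by
    intro s hxs y hy hys h
    refine (Walk.reachable_induce _ h).trans (Adj.reachable ?_)
    simpa using hv.symm
  have hxs : x ∈ insert x {w | w ∈ p.support} := Set.mem_insert _ _
  refine ⟨?_, ?_⟩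
  · have : Nonempty (insert x {w | w ∈ p.support} : Set V) := ⟨⟨x, hxs⟩⟩
    refine ⟨key _ hxs ?_⟩
    rintro ⟨y, rfl | hy⟩
    · rfl
    · exact toU _ hxs y hy _ fun w hw => Or.inr (p.support_takeUntil_subset_support hy hw)
  · intro z _
    by_cases hz : z = x
    · subst hz
      rintro ⟨a, ha⟩ ⟨b, hb⟩
      have ha' : a ∈ p.support := ha.1.resolve_left ha.2
      have hb' : b ∈ p.support := hb.1.resolve_left hb.2
      have sub : ∀ w ∈ p.support, w ∈ insert z {w | w ∈ p.support} \ {z} :=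
        fun w hw => ⟨Or.inr hw, fun h => hx (h ▸ hw)⟩
      exact (Walk.reachable_induce (p.takeUntil a ha')
          fun w hw => sub w (p.support_takeUntil_subset_support ha' hw)).symm.trans
        (Walk.reachable_induce (p.takeUntil b hb')
          fun w hw => sub w (p.support_takeUntil_subset_support hb' hw))
    · have hxs' : x ∈ insert x {w | w ∈ p.support} \ {z} := ⟨hxs, fun h => hz h.symm⟩
      refine key _ hxs' ?_
      rintro ⟨y, rfl | hy, hyz⟩
      · rfl
      -- After deleting z, y still reaches x along the half of the path that misses z: a path visits
      -- z only once, so z cannot lie on both sides of y.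
      by_cases h1 : z ∈ (p.takeUntil y hy).support
      · refine toV _ hxs' y hy _ fun w hw => ⟨Or.inr (p.support_dropUntil_subset_support hy hw), ?_⟩
        rintro rfl
        have hnd := hp.support_nodup
        rw [← p.take_spec hy, Walk.support_append] at hnd
        have hw' : w ∈ (p.dropUntil y hy).support.tail :=
          ((Walk.mem_support_iff _).1 hw).resolve_left fun h => hyz h.symm
        exact (List.nodup_append.1 hnd).2.2 w h1 w hw' rfl
      · refine toU _ hxs' y hy _ fun w hw => ⟨Or.inr (p.support_takeUntil_subset_support hy hw), ?_⟩
        rintro rfl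
        exact h1 hw

theorem IsNonseparableSet.exists_isBlock_superset [Finite V] {G : SimpleGraph V} {s : Set V}
    (hs : G.IsNonseparableSet s) : ∃ t, s ⊆ t ∧ G.IsBlock t :=
  Finite.exists_le_maximal hs

theorem IsBlockGraph.isClique_of_isNonseparableSet [Finite V] {G : SimpleGraph V}
    (hG : G.IsBlockGraph) {s : Set V} (hs : G.IsNonseparableSet s) : G.IsClique s := by
  obtain ⟨t, hst, ht⟩ := hs.exists_isBlock_superset
  exact (hG t ht).subset hst

/-- In a block graph, the neighbours of a vertex in a connected set avoiding it form a clique. -/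
theorem IsBlockGraph.adj_of_preconnected [Finite V] {G : SimpleGraph V} (hG : G.IsBlockGraph)
    {s : Set V} (hs : (G.induce s).Preconnected) {x p q : V} (hx : x ∉ s) (hp : p ∈ s)
    (hq : q ∈ s) (hxp : G.Adj x p) (hxq : G.Adj x q) (hpq : p ≠ q) : G.Adj p q := by
  classical
  obtain ⟨w⟩ := hs ⟨p, hp⟩ ⟨q, hq⟩
  let w' : G.Walk p q := w.map (Embedding.induce s).toHom
  have hw' : ∀ y ∈ w'.support, y ∈ s := by
    intro y hy
    have hy' : y ∈ (w.map (Embedding.induce s).toHom).support := hy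
    rw [Walk.support_map] at hy'
    obtain ⟨z, -, rfl⟩ := List.mem_map.1 hy'
    exact z.2
  have hb : ∀ y ∈ w'.bypass.support, y ∈ s := fun y hy => hw' y (w'.support_bypass_subset_support hy)
  have := hG.isClique_of_isNonseparableSet
    (w'.bypass_isPath.isNonseparableSet_insert (fun h => hx (hb x h)) hxp hxq)
  exact this (Or.inr (Walk.start_mem_support _)) (Or.inr (Walk.end_mem_support _)) hpq

/-- Block graphs contain no induced diamond. -/
theorem IsBlockGraph.adj_of_common_edge [Finite V] {G : SimpleGraph V} (hG : G.IsBlockGraph)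
    {u v p q : V} (huv : G.Adj u v) (hup : G.Adj u p) (huq : G.Adj u q) (hvp : G.Adj v p)
    (hvq : G.Adj v q) (hpq : p ≠ q) : G.Adj p q := by
  have hs : (G.induce {p, u, q}).Preconnected := by
    have key : ∀ y : ({p, u, q} : Set V), (G.induce {p, u, q}).Reachable y ⟨u, by simp⟩ := by
      rintro ⟨y, rfl | rfl | rfl⟩
      · exact Adj.reachable (by simpa using hup.symm)
      · rfl
      · exact Adj.reachable (by simpa using huq.symm)
    exact fun a b => (key a).trans (key b).symm
  refine hG.adj_of_preconnected hs (x := v) ?_ (by simp) (by simp) hvp hvq hpq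
  simp [hvp.ne, hvq.ne, huv.ne']

/-- This set is the block containing the edge uv: it is a clique because there is no induced
diamond, and every nonseparable set around it is a clique through u and v, hence lies inside it. -/
theorem IsUniformBlockGraph.ncard_closed_common_nbhd [Finite V] {G : SimpleGraph V} {k : ℕ}
    (hG : G.IsUniformBlockGraph k) {u v : V} (huv : G.Adj u v) :
    {w | (w = u ∨ G.Adj w u) ∧ (w = v ∨ G.Adj w v)}.ncard = k := by
  obtain ⟨hB, -, hk⟩ := hG
  refine hk _ ?_
  have hcl : G.IsClique {w | (w = u ∨ G.Adj w u) ∧ (w = v ∨ G.Adj w v)} := by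
    intro p hp q hq hpq
    rcases hp with ⟨rfl | hpu, hpv⟩
    · exact (hq.1.resolve_left hpq.symm).symm
    rcases hpv with rfl | hpv
    · exact (hq.2.resolve_left hpq.symm).symm
    rcases hq with ⟨rfl | hqu, hqv⟩
    · exact hpu
    rcases hqv with rfl | hqv
    · exact hpv
    exact hB.adj_of_common_edge huv hpu.symm hqu.symm hpv.symm hqv.symm hpq
  refine ⟨hcl.isNonseparableSet ⟨u, Or.inl rfl, Or.inr huv⟩, fun t ht hle w hw => ?_⟩
  have hct := hB.isClique_of_isNonseparableSet ht
  have hu : u ∈ t := hle ⟨Or.inl rfl, Or.inr huv⟩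
  have hv : v ∈ t := hle ⟨Or.inr huv.symm, Or.inl rfl⟩
  exact ⟨(eq_or_ne w u).imp_right (hct hw hu), (eq_or_ne w v).imp_right (hct hw hv)⟩

/-! ### Forests of blocks -/

open Classical in
/-- The vertex `w` together with its neighbours of the same depth. -/
noncomputable def siblingClass {V : Type*} [Fintype V] (G : SimpleGraph V) (depth : V → ℕ)
    (w : V) : Finset V :=
  {u | u = w ∨ G.Adj u w ∧ depth u = depth w}

open Classical in
/-- The neighbours of `v` whose depth is one more than that of `v`. -/
noncomputable def children {V : Type*} [Fintype V] (G : SimpleGraph V) (depth : V → ℕ)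
    (v : V) : Finset V :=
  {w | G.Adj w v ∧ depth w = depth v + 1}

/-- `depth` makes `G` a forest of blocks of size `k`: every block consists of one vertex and
a sibling class of `k - 1` children of that vertex. -/
structure IsBlockForest {V : Type*} [Fintype V] (G : SimpleGraph V) (k : ℕ) (depth : V → ℕ) :
    Prop where
  depth_le_succ : ∀ {u v}, G.Adj u v → depth u ≤ depth v + 1
  not_adj_of_depth_eq_zero : ∀ {u v}, G.Adj u v → depth u = 0 → depth v ≠ 0
  exists_parent : ∀ {w}, depth w ≠ 0 → ∃ v, w ∈ G.children depth v
  parent_unique : ∀ {w u v}, w ∈ G.children depth u → w ∈ G.children depth v → u = v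
  mem_children_of_adj : ∀ {u w v}, G.Adj u w → depth u = depth w → w ∈ G.children depth v →
    u ∈ G.children depth v
  sibling_trans : ∀ {u w x}, G.Adj u w → G.Adj w x → depth u = depth w → depth w = depth x →
    u ≠ x → G.Adj u x
  card_siblingClass : ∀ {w}, depth w ≠ 0 → (G.siblingClass depth w).card = k - 1

end

section

variable {V : Type*} [Fintype V] {G : SimpleGraph V} {depth : V → ℕ}

theorem mem_siblingClass {u w : V} :
    u ∈ G.siblingClass depth w ↔ u = w ∨ G.Adj u w ∧ depth u = depth w := by
  simp [siblingClass]

theorem mem_children {w v : V} :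
    w ∈ G.children depth v ↔ G.Adj w v ∧ depth w = depth v + 1 := by
  simp [children]

end

/-! ### Distance to the root as depth -/

section

variable {V : Type*} (G : SimpleGraph V)

/-- A vertex chosen in the connected component of `v`. -/
noncomputable def componentRoot (v : V) : V := (G.connectedComponentMk v).out

theorem reachable_componentRoot (v : V) : G.Reachable v (G.componentRoot v) :=
  ConnectedComponent.exact (Quot.out_eq (G.connectedComponentMk v)).symm

variable {G} in
theorem Reachable.componentRoot_eq {u v : V} (h : G.Reachable u v) :
    G.componentRoot u = G.componentRoot v := by
  rw [componentRoot, componentRoot, ConnectedComponent.sound h]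

/-- The distance to the chosen vertex of the component. -/
noncomputable def rootDist (v : V) : ℕ := G.dist v (G.componentRoot v)

variable {G}

theorem Adj.rootDist_le {u v : V} (h : G.Adj u v) : G.rootDist u ≤ G.rootDist v + 1 := by
  obtain ⟨p, hp⟩ := (G.reachable_componentRoot v).exists_walk_length_eq_dist
  rw [rootDist, rootDist, h.reachable.componentRoot_eq, ← hp]
  exact dist_le (p.cons h)

theorem rootDist_eq_zero {v : V} : G.rootDist v = 0 ↔ v = G.componentRoot v :=
  (G.reachable_componentRoot v).dist_eq_zero_iff

theorem exists_adj_rootDist {w : V} (h : G.rootDist w ≠ 0) :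
    ∃ v, G.Adj w v ∧ G.rootDist w = G.rootDist v + 1 := by
  obtain ⟨p, hp⟩ := (G.reachable_componentRoot w).exists_walk_length_eq_dist
  change p.length = G.rootDist w at hp
  generalize hr : G.componentRoot w = r at p
  cases p with
  | nil => exact absurd hp.symm h
  | @cons _ v _ hadj q =>
    refine ⟨v, hadj, le_antisymm hadj.rootDist_le ?_⟩
    rw [← hp, Walk.length_cons, rootDist, ← hadj.reachable.componentRoot_eq, hr]
    exact Nat.succ_le_succ (dist_le q)

/-- The vertices at distance at most `n` from the root of the component of `v`. -/
def rootBall (G : SimpleGraph V) (v : V) (n : ℕ) : Set V :=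
  {y | G.Reachable y v ∧ G.rootDist y ≤ n}

theorem mem_rootBall {v y : V} {n : ℕ} :
    y ∈ G.rootBall v n ↔ G.Reachable y v ∧ G.rootDist y ≤ n := Iff.rfl

/-- Stepping to a neighbour closer to the root never leaves the ball, so the root is reached inside
it. -/
theorem exists_reachable_induce_rootBall (v : V) (n : ℕ) :
    ∀ m y, G.rootDist y = m → ∀ hy : y ∈ G.rootBall v n,
      ∃ hr : G.componentRoot v ∈ G.rootBall v n,
        (G.induce (G.rootBall v n)).Reachable ⟨y, hy⟩ ⟨_, hr⟩ := by
  intro m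
  induction m with
  | zero =>
    intro y hm hy
    have : y = G.componentRoot v := by
      rw [← hy.1.componentRoot_eq]; exact rootDist_eq_zero.1 hm
    subst this
    exact ⟨hy, Reachable.refl _⟩
  | succ m ih =>
    intro y hm hy
    obtain ⟨z, hz, hd⟩ := exists_adj_rootDist (G := G) (w := y) (by omega)
    have hzb : z ∈ G.rootBall v n :=
      ⟨hz.symm.reachable.trans hy.1, by have := (mem_rootBall.1 hy).2; omega⟩
    obtain ⟨hr, h⟩ := ih z (by omega) hzb
    exact ⟨hr, (Adj.reachable (by simpa using hz)).trans h⟩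

theorem preconnected_induce_rootBall (v : V) (n : ℕ) :
    (G.induce (G.rootBall v n)).Preconnected := by
  rintro ⟨a, ha⟩ ⟨b, hb⟩
  obtain ⟨_, h₁⟩ := exists_reachable_induce_rootBall v n _ a rfl ha
  obtain ⟨_, h₂⟩ := exists_reachable_induce_rootBall v n _ b rfl hb
  exact h₁.trans h₂.symm

theorem preconnected_induce_insert {s : Set V} (hs : (G.induce s).Preconnected) {x y : V}
    (hy : y ∈ s) (hxy : G.Adj x y) : (G.induce (insert x s)).Preconnected := by
  have hle : s ≤ insert x s := Set.subset_insert x s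
  have key : ∀ a : (insert x s : Set V), (G.induce (insert x s)).Reachable a ⟨y, hle hy⟩ := by
    rintro ⟨a, rfl | ha⟩
    · exact Adj.reachable (by simpa using hxy)
    · exact (hs ⟨a, ha⟩ ⟨y, hy⟩).map (induceHomOfLE G hle).toHom
  exact fun a b => (key a).trans (key b).symm

/-- In a block graph, a vertex has at most one neighbour closer to the root. -/
theorem IsBlockGraph.eq_of_rootDist_eq [Finite V] (hG : G.IsBlockGraph) {w u v : V}
    (hu : G.Adj w u) (hv : G.Adj w v) (hdu : G.rootDist w = G.rootDist u + 1)
    (hdv : G.rootDist w = G.rootDist v + 1) : u = v := by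
  by_contra huv
  have hwb : w ∉ G.rootBall w (G.rootDist u) := fun h => by have := (mem_rootBall.1 h).2; omega
  have huv' : G.Adj u v := hG.adj_of_preconnected (preconnected_induce_rootBall w _) hwb
    ⟨hu.symm.reachable, le_rfl⟩ ⟨hv.symm.reachable, by omega⟩ hu hv huv
  by_cases h0 : G.rootDist u = 0
  · have hu0 := rootDist_eq_zero.1 h0
    have hv0 := rootDist_eq_zero.1 (show G.rootDist v = 0 by omega)
    rw [huv'.reachable.componentRoot_eq] at hu0
    exact huv (hu0.trans hv0.symm)
  obtain ⟨p, hup, hp⟩ := exists_adj_rootDist (G := G) h0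
  obtain ⟨q, hvq, hq⟩ := exists_adj_rootDist (G := G) (w := v) (by omega)
  have hq' : q ∈ G.rootBall w (G.rootDist p) :=
    ⟨hvq.symm.reachable.trans hv.symm.reachable, by omega⟩
  have hub : u ∉ insert v (G.rootBall w (G.rootDist p)) := by
    rintro (h | h)
    · exact huv h
    · have := (mem_rootBall.1 h).2; omega
  -- The smaller ball with v added is connected and avoids u, so its vertices v and p, both
  -- neighbours of u, are adjacent. Then w and p are both joined to u and v, which forces an edge wp
  -- across two levels.
  have hvp : G.Adj v p := hG.adj_of_preconnected
    (preconnected_induce_insert (preconnected_induce_rootBall w _) hq' hvq) hub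
    (Set.mem_insert _ _) (Or.inr ⟨hup.symm.reachable.trans hu.symm.reachable, le_rfl⟩) huv' hup
    (by rintro rfl; omega)
  have hwp : G.Adj w p := hG.adj_of_common_edge huv' hu.symm hup hv.symm hvp
    (by rintro rfl; omega)
  have := hwp.rootDist_le
  omega

/-- In a block graph, adjacent vertices of equal depth have the same parent. -/
theorem IsBlockGraph.adj_parent_of_adj [Finite V] (hG : G.IsBlockGraph) {u w v : V}
    (huw : G.Adj u w) (hd : G.rootDist u = G.rootDist w) (hwv : G.Adj w v)
    (hdv : G.rootDist w = G.rootDist v + 1) : G.Adj u v := by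
  obtain ⟨p, hup, hp⟩ := exists_adj_rootDist (G := G) (w := u) (by omega)
  have hvb : v ∈ G.rootBall w (G.rootDist v) := ⟨hwv.symm.reachable, le_rfl⟩
  have hub : u ∉ insert w (G.rootBall w (G.rootDist v)) := by
    rintro (h | h)
    · exact huw.ne h
    · have := (mem_rootBall.1 h).2; omega
  have hwp : G.Adj w p := hG.adj_of_preconnected
    (preconnected_induce_insert (preconnected_induce_rootBall w _) hvb hwv) hub
    (Set.mem_insert _ _) (Or.inr ⟨hup.symm.reachable.trans huw.reachable, by omega⟩) huw hup
    (by rintro rfl; omega)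
  rwa [hG.eq_of_rootDist_eq hwv hwp hdv (by omega)]

end

theorem IsUniformBlockGraph.isBlockForest {V : Type*} [Fintype V] {G : SimpleGraph V} {k : ℕ}
    (hG : G.IsUniformBlockGraph k) : G.IsBlockForest k G.rootDist where
  depth_le_succ := Adj.rootDist_le
  not_adj_of_depth_eq_zero := by
    intro u v h hu hv
    rw [rootDist_eq_zero] at hu hv
    rw [h.reachable.componentRoot_eq, ← hv] at hu
    exact h.ne hu
  exists_parent h := (exists_adj_rootDist (G := G) h).imp fun _ hv => mem_children.2 hv
  parent_unique hu hv := by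
    rw [mem_children] at hu hv
    exact hG.1.eq_of_rootDist_eq hu.1 hv.1 hu.2 hv.2
  mem_children_of_adj h hd hw := by
    rw [mem_children] at hw ⊢
    exact ⟨hG.1.adj_parent_of_adj h hd hw.1 hw.2, hd.trans hw.2⟩
  sibling_trans := by
    intro u w x huw hwx hd hd' hux
    by_cases h0 : G.rootDist w = 0
    · rw [rootDist_eq_zero] at h0
      have hu := rootDist_eq_zero.1 (hd.trans (rootDist_eq_zero.2 h0))
      rw [huw.reachable.componentRoot_eq, ← h0] at hu
      exact absurd hu huw.ne
    obtain ⟨v, hwv, hv⟩ := exists_adj_rootDist (G := G) h0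
    exact hG.1.adj_of_common_edge hwv huw.symm hwx
      (hG.1.adj_parent_of_adj huw hd hwv hv).symm
      (hG.1.adj_parent_of_adj hwx.symm hd'.symm hwv hv).symm hux
  card_siblingClass := by
    classical
    intro w h0
    obtain ⟨v, hwv, hv⟩ := exists_adj_rootDist (G := G) h0
    have hk := hG.ncard_closed_common_nbhd hwv
    have hset : {y | (y = w ∨ G.Adj y w) ∧ (y = v ∨ G.Adj y v)} =
        ((insert v (G.siblingClass G.rootDist w) : Finset V) : Set V) := by
      ext y
      simp only [Set.mem_ofPred_eq, Finset.coe_insert, Set.mem_insert_iff, Finset.mem_coe,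
        mem_siblingClass]
      constructor
      · rintro ⟨rfl | hyw, rfl | hyv⟩
        · exact Or.inl rfl
        · exact Or.inr (Or.inl rfl)
        · exact Or.inl rfl
        · refine Or.inr (Or.inr ⟨hyw, ?_⟩)
          by_contra hne
          have h₁ := hyw.symm.rootDist_le
          have h₂ := hyv.rootDist_le
          -- A common neighbour of w and v off the level of w would have the depth of v and be a
          -- second parent of w.
          have := hG.1.eq_of_rootDist_eq hyw.symm hwv (by omega) hv
          exact hyv.ne this
      · rintro (rfl | rfl | ⟨hyw, hd⟩)
        · exact ⟨Or.inr hwv.symm, Or.inl rfl⟩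
        · exact ⟨Or.inl rfl, Or.inr hwv⟩
        · exact ⟨Or.inr hyw, Or.inr (hG.1.adj_parent_of_adj hyw hd hwv hv)⟩
    rw [hset, Set.ncard_coe_finset, Finset.card_insert_of_notMem] at hk
    · omega
    · rw [mem_siblingClass]
      rintro (rfl | ⟨-, hd⟩)
      · exact hwv.ne rfl
      · omega

/-! ### Colouring one sibling class -/

/-- `F e d` is read as: a vertex receiving `e` arcs from its parent block can be completed to
indegree `d` below. A flexible vertex can avoid any `k - 1` colours that do not contain `e`. -/
def IsFlexible (k : ℕ) (F : ℕ → ℕ → Prop) : Prop :=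
  ∀ e ≤ k - 1, ∀ X : Finset ℕ, X.card ≤ k - 1 → e ∉ X → ∃ d ∉ X, F e d

/-- A saturable vertex admits the pair `(0, 0)` and all large colours in its range. -/
def IsSaturable (k : ℕ) (F : ℕ → ℕ → Prop) : Prop :=
  F 0 0 ∧ ∀ e ≤ k - 1, ∀ d, k ≤ d → d ≤ e + k - 1 → F e d

/-- By counting, f is a bijection onto `Finset.range n`. This turns a threshold on positions into a
number of arcs. -/
theorem card_filter_lt_of_injOn {α : Type*} {s : Finset α} {f : α → ℕ} {n m : ℕ}
    (hs : s.card = n) (hf : ∀ x ∈ s, f x < n) (hinj : Set.InjOn f s) (hm : m ≤ n) :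
    (s.filter fun x => f x < m).card = m := by
  have himg : s.image f = Finset.range n := Finset.eq_of_subset_of_card_le
    (Finset.image_subset_iff.2 fun x hx => Finset.mem_range.2 (hf x hx))
    (by rw [Finset.card_image_of_injOn hinj, hs, Finset.card_range])
  rw [← Finset.card_image_of_injOn (f := f) (hinj.mono (Finset.filter_subset _ s)),
    show (s.filter fun x => f x < m).image f = Finset.range m from ?_, Finset.card_range]
  ext i
  simp only [Finset.mem_image, Finset.mem_filter, Finset.mem_range]
  constructor
  · rintro ⟨x, ⟨-, hx⟩, rfl⟩
    exact hx
  · intro hi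
    obtain ⟨x, hx, rfl⟩ := Finset.mem_image.1 (himg ▸ Finset.mem_range.2 (hi.trans_le hm))
    exact ⟨x, ⟨hx, hi⟩, rfl⟩

/-- The sibling class `C` below a vertex of indegree `d`, to which it sends `t` arcs, can be
completed: the siblings are ordered transitively by `pos`, the first `t` of them send their arc
to the parent and the others receive it. -/
def ClassExtends {V : Type*} (k : ℕ) (F : V → ℕ → ℕ → Prop) (C : Finset V) (d t : ℕ) : Prop :=
  ∃ pos col : V → ℕ, (∀ w ∈ C, pos w < k - 1) ∧ Set.InjOn pos C ∧ Set.InjOn col C ∧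
    (∀ w ∈ C, col w ≠ d) ∧ ∀ w ∈ C, F w (pos w + if t ≤ pos w then 1 else 0) (col w)

section

variable {V : Type*} {k : ℕ} {F : V → ℕ → ℕ → Prop} {C : Finset V}

/-- Vertices are recoloured one at a time. Each must avoid d and the current colours of the at most
k - 2 others, and its own old colour is never among these, so the hypothesis on forbidden sets
applies. -/
theorem exists_recolor {F : V → ℕ → Prop} {d : ℕ} (hC : C.card ≤ k - 1) {col : V → ℕ}
    (hinj : Set.InjOn col C) (hd : ∀ w ∈ C, col w ≠ d)
    (hF : ∀ w ∈ C, ∀ X : Finset ℕ, X.card ≤ k - 1 → col w ∉ X → ∃ c ∉ X, F w c) :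
    ∃ col' : V → ℕ, Set.InjOn col' C ∧ (∀ w ∈ C, col' w ≠ d) ∧ ∀ w ∈ C, F w (col' w) := by
  classical
  suffices H : ∀ T ⊆ C, ∃ col' : V → ℕ, Set.InjOn col' C ∧ (∀ w ∈ C, col' w ≠ d) ∧
      (∀ w ∈ T, F w (col' w)) ∧ ∀ w, w ∉ T → col' w = col w by
    obtain ⟨col', h₁, h₂, h₃, -⟩ := H C subset_rfl
    exact ⟨col', h₁, h₂, h₃⟩
  intro T
  induction T using Finset.induction_on with
  | empty => exact fun _ => ⟨col, hinj, hd, by simp, fun _ _ => rfl⟩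
  | insert a T ha ih =>
    intro hT
    rw [Finset.insert_subset_iff] at hT
    obtain ⟨col', h₁, h₂, h₃, h₄⟩ := ih hT.2
    have hcard : (insert d ((C.erase a).image col')).card ≤ k - 1 := by
      have h := Finset.card_insert_le d ((C.erase a).image col')
      have h' := Finset.card_image_le (s := C.erase a) (f := col')
      have h'' := Finset.card_erase_add_one hT.1
      omega
    obtain ⟨c, hcX, hc⟩ := hF a hT.1 _ hcard (by
      rw [← h₄ a ha, Finset.mem_insert, Finset.mem_image]
      rintro (h | ⟨b, hb, hba⟩)
      · exact h₂ a hT.1 h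
      · rw [Finset.mem_erase] at hb
        exact hb.1 (h₁ hb.2 hT.1 hba))
    rw [Finset.mem_insert, Finset.mem_image, not_or] at hcX
    have hne : ∀ b ∈ C, b ≠ a → col' b ≠ c := fun b hb hba h =>
      hcX.2 ⟨b, Finset.mem_erase.2 ⟨hba, hb⟩, h⟩
    refine ⟨Function.update col' a c, ?_, ?_, ?_, ?_⟩
    · intro x hx y hy hxy
      by_cases hxa : x = a <;> by_cases hya : y = a
      · rw [hxa, hya]
      · subst hxa
        rw [Function.update_self, Function.update_of_ne hya] at hxy
        exact absurd hxy.symm (hne y hy hya)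
      · subst hya
        rw [Function.update_self, Function.update_of_ne hxa] at hxy
        exact absurd hxy (hne x hx hxa)
      · rw [Function.update_of_ne hxa, Function.update_of_ne hya] at hxy
        exact h₁ hx hy hxy
    · intro w hw
      by_cases hwa : w = a
      · subst hwa; rw [Function.update_self]; exact hcX.1
      · rw [Function.update_of_ne hwa]; exact h₂ w hw
    · intro w hw
      by_cases hwa : w = a
      · subst hwa; rwa [Function.update_self]
      · rw [Function.update_of_ne hwa]; exact h₃ w ((Finset.mem_insert.1 hw).resolve_left hwa)
    · intro w hw
      rw [Finset.mem_insert, not_or] at hw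
      rw [Function.update_of_ne hw.1]
      exact h₄ w hw.2

theorem exists_position (hC : C.card = k - 1) {a : V} (ha : a ∈ C) {i : ℕ} (hi : i < k - 1) :
    ∃ pos : V → ℕ, (∀ w ∈ C, pos w < k - 1) ∧ Set.InjOn pos C ∧ pos a = i := by
  classical
  let f : V → ℕ := fun w => if h : w ∈ C then C.equivFin ⟨w, h⟩ else 0
  have hf : ∀ w ∈ C, f w < k - 1 := by
    intro w hw
    simp only [f, hw, dif_pos]
    exact hC ▸ (C.equivFin ⟨w, hw⟩).2
  have hinj : Set.InjOn f C := by
    intro x hx y hy hxy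
    rw [Finset.mem_coe] at hx hy
    simp only [f, hx, hy, dif_pos] at hxy
    simpa using C.equivFin.injective (Fin.ext hxy)
  -- Any enumeration of C serves after exchanging the position of a with i.
  refine ⟨fun w => Equiv.swap (f a) i (f w), ?_, ?_, Equiv.swap_apply_left _ _⟩
  · intro w hw
    have h₁ := hf w hw
    have h₂ := hf a ha
    simp only [Equiv.swap_apply_def]
    split_ifs <;> assumption
  · exact fun x hx y hy hxy => hinj hx hy ((Equiv.swap _ _).injective hxy)

theorem ClassExtends.of_initial (hC : C.card = k - 1) {d t : ℕ} {pos col : V → ℕ}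
    (hpos : ∀ w ∈ C, pos w < k - 1) (hinj : Set.InjOn pos C) (hcol : Set.InjOn col C)
    (hd : ∀ w ∈ C, col w ≠ d)
    (hF : ∀ w ∈ C, (IsFlexible k (F w) ∧ col w = pos w + if t ≤ pos w then 1 else 0) ∨
      F w (pos w + if t ≤ pos w then 1 else 0) (col w)) :
    ClassExtends k F C d t := by
  obtain ⟨col', h₁, h₂, h₃⟩ := exists_recolor
    (F := fun w c => F w (pos w + if t ≤ pos w then 1 else 0) c) hC.le hcol hd (by
      intro w hw X hX hwX
      rcases hF w hw with ⟨h, he⟩ | h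
      · refine h _ ?_ X hX (he ▸ hwX)
        have := hpos w hw
        split_ifs <;> omega
      · exact ⟨_, hwX, h⟩)
  exact ⟨pos, col', hpos, hinj, h₁, h₂, h₃⟩

/-- The starting colours d = e fill 0, ..., k - 1 except t, so they avoid the parent's colour when
it is at least k, or when it is 0 and t = 0. -/
theorem classExtends_of_forall_flexible (hC : C.card = k - 1) (hne : C.Nonempty)
    (hflex : ∀ w ∈ C, IsFlexible k (F w)) {d t : ℕ} (h : d = 0 ∧ t = 0 ∨ k ≤ d) :
    ClassExtends k F C d t := by
  obtain ⟨a, ha⟩ := hne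
  have hk : 0 < k - 1 := hC ▸ Finset.card_pos.2 ⟨a, ha⟩
  obtain ⟨pos, hpos, hinj, -⟩ := exists_position hC ha hk
  refine .of_initial (col := fun w => pos w + if t ≤ pos w then 1 else 0) hC hpos hinj ?_ ?_
    fun w hw => Or.inl ⟨hflex w hw, rfl⟩
  · intro x hx y hy hxy
    refine hinj hx hy ?_
    dsimp only at hxy
    split_ifs at hxy <;> omega
  · intro w hw
    have := hpos w hw
    split_ifs <;> omega

theorem classExtends_of_forall_saturable (hC : C.card = k - 1) (hne : C.Nonempty)
    (hsat : ∀ w ∈ C, IsSaturable k (F w)) {d t : ℕ}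
    (h : t = 0 ∧ (d < k ∨ 2 * k ≤ d + 1) ∨ 1 ≤ t ∧ t + k ≤ d + 1) :
    ClassExtends k F C d t := by
  obtain ⟨a, ha⟩ := hne
  have hk : 0 < k - 1 := hC ▸ Finset.card_pos.2 ⟨a, ha⟩
  obtain ⟨pos, hpos, hinj, -⟩ := exists_position hC ha hk
  rcases h with ⟨rfl, h⟩ | ⟨ht, h⟩
  -- Here e = pos + 1, so k + pos is the largest colour saturability grants; together these fill k,
  -- ..., 2k - 2, which d must avoid.
  · refine .of_initial (col := fun w => k + pos w) hC hpos hinj ?_ ?_ ?_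
    · intro x hx y hy hxy
      refine hinj hx hy ?_
      dsimp only at hxy
      omega
    · intro w hw
      have := hpos w hw
      omega
    · intro w hw
      have := hpos w hw
      refine Or.inr ((hsat w hw).2 _ ?_ _ (by omega) ?_) <;> simp <;> omega
  -- The first sibling uses the pair (0, 0), freeing one large colour so that d can be skipped. A
  -- colour shifted up to k + pos needs e = pos + 1, that is t ≤ pos; this follows from t + k ≤ d +
  -- 1.
  · refine .of_initial (col := fun w => if pos w = 0 then 0 else
        if k + pos w - 1 < d then k + pos w - 1 else k + pos w) hC hpos hinj ?_ ?_ ?_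
    · intro x hx y hy hxy
      refine hinj hx hy ?_
      dsimp only at hxy
      split_ifs at hxy <;> omega
    · intro w hw
      have := hpos w hw
      split_ifs <;> omega
    · intro w hw
      have := hpos w hw
      refine Or.inr ?_
      by_cases h0 : pos w = 0
      · simpa [h0, show ¬ t ≤ 0 by omega] using (hsat w hw).1
      · rw [if_neg h0]
        refine (hsat w hw).2 _ ?_ _ ?_ ?_ <;> split_ifs <;> omega

theorem classExtends_of_mixed (hC : C.card = k - 1) {a b : V} (ha : a ∈ C) (hb : b ∈ C)
    (hfa : IsFlexible k (F a)) (hfb : ¬ IsFlexible k (F b))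
    (hC' : ∀ w ∈ C, IsFlexible k (F w) ∨ IsSaturable k (F w)) (d : ℕ) :
    ClassExtends k F C d 0 := by
  classical
  have hk : 0 < k - 1 := hC ▸ Finset.card_pos.2 ⟨a, ha⟩
  by_cases hd : d < k
  -- The non-flexible b takes the position whose starting colour would be d. For d = 0 the truncated
  -- position 0 does no harm, since all starting colours are positive.
  · obtain ⟨pos, hpos, hinj, hposb⟩ := exists_position hC hb (i := d - 1) (by omega)
    refine .of_initial (col := fun w => if IsFlexible k (F w) then pos w + 1 else k + pos w)
      hC hpos hinj ?_ ?_ ?_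
    · intro x hx y hy hxy
      have := hpos x hx
      have := hpos y hy
      refine hinj hx hy ?_
      dsimp only at hxy
      split_ifs at hxy <;> omega
    · intro w hw
      have := hpos w hw
      split_ifs with hw'
      · intro h
        refine hfb (hinj hw hb ?_ ▸ hw')
        omega
      · omega
    · intro w hw
      have := hpos w hw
      by_cases hw' : IsFlexible k (F w)
      · exact Or.inl ⟨hw', by simp [hw']⟩
      · refine Or.inr ?_
        simp only [hw', if_false, Nat.zero_le, if_true]
        exact ((hC' w hw).resolve_left hw').2 _ (by omega) _ (by omega) (by omega)
  -- With a flexible vertex first, the saturable ones have pos ≥ 1; their colours may then start at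
  -- k + pos - 1 and shift up past d, while flexible starting colours stay below k.
  · obtain ⟨pos, hpos, hinj, hposa⟩ := exists_position hC ha hk
    have h0 : ∀ w ∈ C, ¬ IsFlexible k (F w) → pos w ≠ 0 := fun w hw hw' h =>
      hw' (hinj hw ha (h.trans hposa.symm) ▸ hfa)
    refine .of_initial (col := fun w => if IsFlexible k (F w) then pos w + 1 else
      if k + pos w - 1 < d then k + pos w - 1 else k + pos w) hC hpos hinj ?_ ?_ ?_
    · intro x hx y hy hxy
      have := hpos x hx
      have := hpos y hy
      refine hinj hx hy ?_
      by_cases hx' : IsFlexible k (F x) <;> by_cases hy' : IsFlexible k (F y) <;>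
        simp only [hx', hy', if_true, if_false] at hxy
      · omega
      · have := h0 y hy hy'
        split_ifs at hxy <;> omega
      · have := h0 x hx hx'
        split_ifs at hxy <;> omega
      · have := h0 x hx hx'
        have := h0 y hy hy'
        split_ifs at hxy <;> omega
    · intro w hw
      have := hpos w hw
      split_ifs <;> omega
    · intro w hw
      have := hpos w hw
      by_cases hw' : IsFlexible k (F w)
      · exact Or.inl ⟨hw', by simp [hw']⟩
      · have := h0 w hw hw'
        refine Or.inr ?_
        simp only [hw', if_false, Nat.zero_le, if_true]
        refine ((hC' w hw).resolve_left hw').2 _ (by omega) _ ?_ ?_ <;> split_ifs <;> omega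

theorem exists_ge_lt_add_notMem {n : ℕ} (a : ℕ) {X : Finset ℕ} (hX : X.card < n) :
    ∃ d, a ≤ d ∧ d < a + n ∧ d ∉ X := by
  obtain ⟨d, hd, hdX⟩ := Finset.exists_mem_notMem_of_card_lt_card
    (s := X) (t := Finset.Ico a (a + n)) (by simpa using hX)
  rw [Finset.mem_Ico] at hd
  exact ⟨d, hd.1, hd.2, hdX⟩

theorem exists_sum_eq_pair {ι : Type*} {s : Finset ι} {i j : ι} (hi : i ∈ s) (hj : j ∈ s)
    (hij : i ≠ j) (a b : ℕ) : ∃ T : ι → ℕ, ∑ x ∈ s, T x = a + b ∧ T i = a ∧ T j = b ∧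
      ∀ x, x ≠ i → x ≠ j → T x = 0 := by
  classical
  refine ⟨fun x => if x = i then a else if x = j then b else 0, ?_, by simp, by simp [hij.symm],
    fun x h₁ h₂ => by simp [h₁, h₂]⟩
  rw [← Finset.sum_subset (s₁ := {i, j}) (by simp [Finset.insert_subset_iff, hi, hj])]
  · rw [Finset.sum_pair hij]; simp [hij.symm]
  · intro x _ hx
    simp only [Finset.mem_insert, Finset.mem_singleton, not_or] at hx
    simp [hx]

theorem exists_sum_eq_triple {ι : Type*} {s : Finset ι} {i j l : ι} (hi : i ∈ s) (hj : j ∈ s)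
    (hl : l ∈ s) (hij : i ≠ j) (hil : i ≠ l) (hjl : j ≠ l) (a b c : ℕ) :
    ∃ T : ι → ℕ, ∑ x ∈ s, T x = a + b + c ∧ T i = a ∧ T j = b ∧ T l = c ∧
      ∀ x, x ≠ i → x ≠ j → x ≠ l → T x = 0 := by
  classical
  refine ⟨fun x => if x = i then a else if x = j then b else if x = l then c else 0, ?_, by simp,
    by simp [hij.symm], by simp [hil.symm, hjl.symm], fun x h₁ h₂ h₃ => by simp [h₁, h₂, h₃]⟩
  rw [← Finset.sum_subset (s₁ := {i, j, l}) (by simp [Finset.insert_subset_iff, hi, hj, hl])]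
  · rw [Finset.sum_insert (by simp [hij, hil]), Finset.sum_pair hjl]
    simp [hij.symm, hil.symm, hjl.symm, add_assoc]
  · intro x _ hx
    simp only [Finset.mem_insert, Finset.mem_singleton, not_or] at hx
    simp [hx]

variable {Fv : ℕ → ℕ → Prop} {𝒞 : Finset (Finset V)}

/-- This is the inductive step of the colouring argument; T distributes the d - e arcs coming from
below among the sibling classes. -/
theorem isFlexible_or_isSaturable (hk : 1 ≤ k) (hcard : ∀ C ∈ 𝒞, C.card = k - 1)
    (hne : ∀ C ∈ 𝒞, C.Nonempty)
    (hC : ∀ C ∈ 𝒞, ∀ w ∈ C, IsFlexible k (F w) ∨ IsSaturable k (F w))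
    (hFv : ∀ (T : Finset V → ℕ) (e d : ℕ), e + ∑ C ∈ 𝒞, T C = d → d ≤ 3 * k - 2 →
      (∀ C ∈ 𝒞, T C ≤ k - 1 ∧ ClassExtends k F C d (T C)) → Fv e d) :
    Fv 0 0 ∧ (IsFlexible k Fv ∨ IsSaturable k Fv) := by
  have hE : ∀ C ∈ 𝒞, (∀ w ∈ C, IsFlexible k (F w)) → ∀ {d t}, d = 0 ∧ t = 0 ∨ k ≤ d →
      ClassExtends k F C d t := fun C hC' h _ _ =>
    classExtends_of_forall_flexible (hcard C hC') (hne C hC') h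
  have hS : ∀ C ∈ 𝒞, (∀ w ∈ C, ¬ IsFlexible k (F w)) → ∀ {d t},
      t = 0 ∧ (d < k ∨ 2 * k ≤ d + 1) ∨ 1 ≤ t ∧ t + k ≤ d + 1 → ClassExtends k F C d t :=
    fun C hC' h _ _ => classExtends_of_forall_saturable (hcard C hC') (hne C hC')
      fun w hw => (hC C hC' w hw).resolve_left (h w hw)
  have hM : ∀ C ∈ 𝒞, ¬ (∀ w ∈ C, IsFlexible k (F w)) → ¬ (∀ w ∈ C, ¬ IsFlexible k (F w)) →
      ∀ d, ClassExtends k F C d 0 := by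
    intro C hC' h₁ h₂
    push Not at h₁ h₂
    obtain ⟨b, hb, hb'⟩ := h₁
    obtain ⟨a, ha, ha'⟩ := h₂
    exact classExtends_of_mixed (hcard C hC') ha hb ha' hb' (hC C hC')
  have hES : ∀ C ∈ 𝒞, (∀ w ∈ C, IsFlexible k (F w)) → ¬ (∀ w ∈ C, ¬ IsFlexible k (F w)) := by
    intro C hC' h h'
    obtain ⟨w, hw⟩ := hne C hC'
    exact h' w hw (h w hw)
  have h00 : Fv 0 0 := by
    refine hFv 0 0 0 (by simp) (by omega) fun C hC' => ⟨Nat.zero_le _, ?_⟩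
    by_cases h₁ : ∀ w ∈ C, IsFlexible k (F w)
    · exact hE C hC' h₁ (Or.inl ⟨rfl, rfl⟩)
    by_cases h₂ : ∀ w ∈ C, ¬ IsFlexible k (F w)
    · exact hS C hC' h₂ (Or.inl ⟨rfl, by omega⟩)
    exact hM C hC' h₁ h₂ 0
  refine ⟨h00, ?_⟩
  have hzero : ∀ C ∈ 𝒞, ∀ d, k ≤ d → ((∀ w ∈ C, ¬ IsFlexible k (F w)) → 2 * k ≤ d + 1) →
      ClassExtends k F C d 0 := by
    intro C hC' d hd h
    by_cases h₁ : ∀ w ∈ C, IsFlexible k (F w)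
    · exact hE C hC' h₁ (Or.inr hd)
    by_cases h₂ : ∀ w ∈ C, ¬ IsFlexible k (F w)
    · exact hS C hC' h₂ (Or.inl ⟨rfl, Or.inr (h h₂)⟩)
    exact hM C hC' h₁ h₂ d
  have flex : (∀ e, 1 ≤ e → e ≤ k - 1 → ∃ a, ∀ d, a ≤ d → d < a + k → Fv e d) →
      IsFlexible k Fv := by
    intro h e he X hX heX
    rcases Nat.eq_zero_or_pos e with rfl | he0
    · exact ⟨0, heX, h00⟩
    obtain ⟨a, ha⟩ := h e he0 he
    obtain ⟨d, h₁, h₂, h₃⟩ := exists_ge_lt_add_notMem a (show X.card < k by omega)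
    exact ⟨d, h₃, ha d h₁ h₂⟩
  by_cases hexE : ∃ A ∈ 𝒞, ∀ w ∈ A, IsFlexible k (F w)
  swap
  -- Without an all-flexible class nothing need be sent up: d = e < k suits the other two kinds with
  -- t = 0.
  · left
    intro e he X hX heX
    refine ⟨e, heX, hFv 0 e e (by simp) (by omega) fun C hC' => ⟨Nat.zero_le _, ?_⟩⟩
    by_cases h₂ : ∀ w ∈ C, ¬ IsFlexible k (F w)
    · exact hS C hC' h₂ (Or.inl ⟨rfl, by omega⟩)
    exact hM C hC' (fun h => hexE ⟨C, hC', h⟩) h₂ e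
  obtain ⟨A, hA, hAE⟩ := hexE
  by_cases hexS : ∃ B ∈ 𝒞, ∀ w ∈ B, ¬ IsFlexible k (F w)
  · obtain ⟨B, hB, hBS⟩ := hexS
    have hAB : A ≠ B := by rintro rfl; exact hES A hA hAE hBS
    by_cases hexS' : ∃ B' ∈ 𝒞, B' ≠ B ∧ ∀ w ∈ B', ¬ IsFlexible k (F w)
    · obtain ⟨B', hB', hBB, hBS'⟩ := hexS'
      have hAB' : A ≠ B' := by rintro rfl; exact hES A hA hAE hBS'
      -- From 2k - 1 on, a class without flexible vertices accepts every t ≤ k - 1. As e ≥ 1, three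
      -- classes of capacity k - 1 suffice up to 3k - 2.
      refine Or.inl (flex fun e he0 he => ⟨2 * k - 1, fun d hd hd' => ?_⟩)
      obtain ⟨T, hsum, hTA, hTB, hTB', hT0⟩ := exists_sum_eq_triple hA hB hB' hAB hAB' hBB.symm
        (min (k - 1) (d - e)) (min (k - 1) (d - e - (k - 1))) (d - e - (k - 1) - (k - 1))
      refine hFv T e d (by omega) (by omega) fun C hC' => ?_
      by_cases h₁ : C = A
      · subst h₁
        exact ⟨by omega, hE C hC' hAE (Or.inr (by omega))⟩
      by_cases h₂ : C = B
      · subst h₂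
        exact ⟨by omega, hS C hC' hBS (by omega)⟩
      by_cases h₃ : C = B'
      · subst h₃
        exact ⟨by omega, hS C hC' hBS' (by omega)⟩
      rw [hT0 C h₁ h₂ h₃]
      exact ⟨by omega, hzero C hC' d (by omega) fun _ => by omega⟩
    · refine Or.inl (flex fun e he0 he => ⟨k, fun d hd hd' => ?_⟩)
      -- The subtracted 1 reserves an arc for B, which may refuse t = 0 when k ≤ d ≤ 2k - 2.
      obtain ⟨T, hsum, hTA, hTB, hT0⟩ := exists_sum_eq_pair hA hB hAB
        (min (k - 1) (d - e - 1)) (d - e - min (k - 1) (d - e - 1))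
      refine hFv T e d (by omega) (by omega) fun C hC' => ?_
      by_cases h₁ : C = A
      · subst h₁
        exact ⟨by omega, hE C hC' hAE (Or.inr (by omega))⟩
      by_cases h₂ : C = B
      · subst h₂
        exact ⟨by omega, hS C hC' hBS (by omega)⟩
      rw [hT0 C h₁ h₂]
      exact ⟨by omega, hzero C hC' d (by omega) fun h => absurd ⟨C, hC', h₂, h⟩ hexS'⟩
  · by_cases hexE' : ∃ B ∈ 𝒞, B ≠ A ∧ ∀ w ∈ B, IsFlexible k (F w)
    · obtain ⟨B, hB, hBA, hBE⟩ := hexE'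
      refine Or.inl (flex fun e he0 he => ⟨k, fun d hd hd' => ?_⟩)
      obtain ⟨T, hsum, hTA, hTB, hT0⟩ := exists_sum_eq_pair hA hB hBA.symm
        (min (k - 1) (d - e)) (d - e - min (k - 1) (d - e))
      refine hFv T e d (by omega) (by omega) fun C hC' => ?_
      by_cases h₁ : C = A
      · subst h₁
        exact ⟨by omega, hE C hC' hAE (Or.inr (by omega))⟩
      by_cases h₂ : C = B
      · subst h₂
        exact ⟨by omega, hE C hC' hBE (Or.inr (by omega))⟩
      rw [hT0 C h₁ h₂]
      exact ⟨by omega, hzero C hC' d (by omega) fun h => absurd ⟨C, hC', h⟩ hexS⟩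
    -- A is the only all-flexible class and no class is free of flexible vertices; the capacity k -
    -- 1 of A gives the range d ≤ e + k - 1 of saturability.
    · classical
      refine Or.inr ⟨h00, fun e he d hd hd' => ?_⟩
      refine hFv (fun C => if C = A then d - e else 0) e d ?_ (by omega) fun C hC' => ?_
      · rw [Finset.sum_ite_eq' 𝒞 A, if_pos hA]; omega
      by_cases h₁ : C = A
      · subst h₁
        simp only [if_true]
        exact ⟨by omega, hE C hC' hAE (Or.inr (by omega))⟩
      simp only [h₁, if_false]
      exact ⟨by omega, hzero C hC' d (by omega) fun h => absurd ⟨C, hC', h⟩ hexS⟩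

end

/-! ### Assembling the local choices -/

section

variable {V : Type*} [Fintype V] {G : SimpleGraph V} {k : ℕ} {depth : V → ℕ}

open Classical in
/-- If `v` receives `e` arcs from its parent block, then the part of the graph below `v` can be
properly oriented so that `v` has indegree `d`. -/
inductive OrientableBelow (G : SimpleGraph V) (k : ℕ) (depth : V → ℕ) : V → ℕ → ℕ → Prop
  | intro {v : V} {e d : ℕ} (pos t col : V → ℕ)
      (pos_lt : ∀ w ∈ G.children depth v, pos w < k - 1)
      (adj : ∀ w ∈ G.children depth v, ∀ w' ∈ G.children depth v, G.Adj w w' →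
        pos w ≠ pos w' ∧ t w = t w' ∧ col w ≠ col w')
      (col_ne : ∀ w ∈ G.children depth v, col w ≠ d)
      (count : e + ((G.children depth v).filter fun w => pos w < t w).card = d)
      (le : d ≤ 3 * k - 2)
      (below : ∀ w ∈ G.children depth v,
        OrientableBelow G k depth w (pos w + if t w ≤ pos w then 1 else 0) (col w)) :
      OrientableBelow G k depth v e d

theorem mem_siblingClass_self (w : V) : w ∈ G.siblingClass depth w :=
  mem_siblingClass.2 (Or.inl rfl)

namespace IsBlockForest

variable (h : G.IsBlockForest k depth)

include h

theorem siblingClass_eq {u w : V} (huw : u ∈ G.siblingClass depth w) :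
    G.siblingClass depth u = G.siblingClass depth w := by
  rw [mem_siblingClass] at huw
  rcases huw with rfl | ⟨huw, hd⟩
  · rfl
  ext x
  rw [mem_siblingClass, mem_siblingClass]
  constructor
  · rintro (rfl | ⟨hx, hdx⟩)
    · exact Or.inr ⟨huw, hd⟩
    · by_cases hxw : x = w
      · exact Or.inl hxw
      · exact Or.inr ⟨h.sibling_trans hx huw hdx hd hxw, hdx.trans hd⟩
  · rintro (rfl | ⟨hx, hdx⟩)
    · exact Or.inr ⟨huw.symm, hd.symm⟩
    · by_cases hxu : x = u
      · exact Or.inl hxu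
      · exact Or.inr ⟨h.sibling_trans hx huw.symm hdx hd.symm hxu, hdx.trans hd.symm⟩

theorem siblingClass_subset_children {w v : V} (hw : w ∈ G.children depth v) :
    G.siblingClass depth w ⊆ G.children depth v := by
  intro u hu
  rw [mem_siblingClass] at hu
  rcases hu with rfl | ⟨hu, hd⟩
  · exact hw
  · exact h.mem_children_of_adj hu hd hw

/-- Sibling classes partition the children and are not joined to each other, so their choices are
independent and the arcs they send to v add up. -/
theorem orientableBelow_of_classExtends [DecidableEq (Finset V)] {v : V} {e d : ℕ}
    (T : Finset V → ℕ)
    (hsum : e + ∑ C ∈ (G.children depth v).image (G.siblingClass depth), T C = d)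
    (hd : d ≤ 3 * k - 2)
    (hT : ∀ C ∈ (G.children depth v).image (G.siblingClass depth),
      T C ≤ k - 1 ∧ ClassExtends k (G.OrientableBelow k depth) C d (T C)) :
    G.OrientableBelow k depth v e d := by
  classical
  have hT' : ∀ C, ∃ pos col : V → ℕ,
      C ∈ (G.children depth v).image (G.siblingClass depth) →
      (∀ w ∈ C, pos w < k - 1) ∧ Set.InjOn pos C ∧ Set.InjOn col C ∧ (∀ w ∈ C, col w ≠ d) ∧
        ∀ w ∈ C, G.OrientableBelow k depth w (pos w + if T C ≤ pos w then 1 else 0) (col w) := by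
    intro C
    by_cases hC : C ∈ (G.children depth v).image (G.siblingClass depth)
    · obtain ⟨pos, col, h'⟩ := (hT C hC).2
      exact ⟨pos, col, fun _ => h'⟩
    · exact ⟨0, 0, fun h' => absurd h' hC⟩
  choose pos col hpc using hT'
  have hcls : ∀ w ∈ G.children depth v,
      G.siblingClass depth w ∈ (G.children depth v).image (G.siblingClass depth) :=
    fun w hw => Finset.mem_image_of_mem _ hw
  refine .intro (fun w => pos (G.siblingClass depth w) w) (fun w => T (G.siblingClass depth w))
    (fun w => col (G.siblingClass depth w) w) ?_ ?_ ?_ ?_ hd ?_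
  · exact fun w hw => (hpc _ (hcls w hw)).1 w (mem_siblingClass_self w)
  · intro w hw w' hw' hadj
    have hd' : depth w = depth w' := by
      rw [mem_children] at hw hw'; omega
    have hmem : w ∈ G.siblingClass depth w' := mem_siblingClass.2 (Or.inr ⟨hadj, hd'⟩)
    obtain ⟨-, h₁, h₂, -⟩ := hpc _ (hcls w' hw')
    rw [h.siblingClass_eq hmem]
    exact ⟨fun heq => hadj.ne (h₁ hmem (mem_siblingClass_self w') heq), rfl,
      fun heq => hadj.ne (h₂ hmem (mem_siblingClass_self w') heq)⟩
  · exact fun w hw => (hpc _ (hcls w hw)).2.2.2.1 w (mem_siblingClass_self w)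
  · rw [← hsum, Finset.card_eq_sum_card_fiberwise (f := G.siblingClass depth)
      (t := (G.children depth v).image (G.siblingClass depth))]
    · congr 1
      refine Finset.sum_congr rfl fun C hC => ?_
      obtain ⟨h₁, h₂, -⟩ := hpc C hC
      obtain ⟨w₀, hw₀, rfl⟩ := Finset.mem_image.1 hC
      have hfib : (((G.children depth v).filter
          fun w => pos (G.siblingClass depth w) w < T (G.siblingClass depth w)).filter
          fun w => G.siblingClass depth w = G.siblingClass depth w₀) =
          (G.siblingClass depth w₀).filter
            fun w => pos (G.siblingClass depth w₀) w < T (G.siblingClass depth w₀) := by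
        ext w
        simp only [Finset.mem_filter]
        constructor
        · rintro ⟨⟨-, hlt⟩, heq⟩
          rw [heq] at hlt
          exact ⟨heq ▸ mem_siblingClass_self w, hlt⟩
        · rintro ⟨hw, hlt⟩
          rw [h.siblingClass_eq hw]
          exact ⟨⟨h.siblingClass_subset_children hw₀ hw, hlt⟩, rfl⟩
      have hcard := h.card_siblingClass (w := w₀) (by rw [mem_children] at hw₀; omega)
      rw [hfib]
      exact card_filter_lt_of_injOn hcard h₁ h₂ (hT _ hC).1
    · exact fun w hw => hcls w (Finset.mem_filter.1 hw).1
  · exact fun w hw => (hpc _ (hcls w hw)).2.2.2.2 w (mem_siblingClass_self w)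

/-- Induction from the deepest level upwards: passing to a child decreases the gap to the maximal
depth. -/
theorem orientableBelow (hk : 1 ≤ k) (v : V) :
    G.OrientableBelow k depth v 0 0 ∧
      (IsFlexible k (G.OrientableBelow k depth v) ∨
        IsSaturable k (G.OrientableBelow k depth v)) := by
  classical
  induction hn : Finset.univ.sup depth - depth v using Nat.strong_induction_on generalizing v with
  | _ n ih =>
  subst hn
  refine isFlexible_or_isSaturable (F := G.OrientableBelow k depth)
    (𝒞 := (G.children depth v).image (G.siblingClass depth)) hk ?_ ?_ ?_
    fun T e d => h.orientableBelow_of_classExtends T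
  · intro C hC
    obtain ⟨w, hw, rfl⟩ := Finset.mem_image.1 hC
    exact h.card_siblingClass (by rw [mem_children] at hw; omega)
  · intro C hC
    obtain ⟨w, hw, rfl⟩ := Finset.mem_image.1 hC
    exact ⟨w, mem_siblingClass_self w⟩
  · intro C hC u hu
    obtain ⟨w, hw, rfl⟩ := Finset.mem_image.1 hC
    have hu' := (mem_children.1 (h.siblingClass_subset_children hw hu)).2
    have hle : depth u ≤ Finset.univ.sup depth := Finset.le_sup (Finset.mem_univ u)
    exact (ih _ (by omega) u rfl).2

end IsBlockForest

/-- Vertex data encoding a proper orientation of a block forest: `pos` orders each sibling class,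
the first `t` vertices of which send their arc to the parent, and `d` is the indegree. -/
structure IsOrientationData (G : SimpleGraph V) (k : ℕ) (depth pos t d : V → ℕ) : Prop where
  pos_lt : ∀ w, depth w ≠ 0 → pos w < k - 1
  sibling : ∀ w w', G.Adj w w' → depth w = depth w' → pos w ≠ pos w' ∧ t w = t w' ∧ d w ≠ d w'
  parent : ∀ w v, w ∈ G.children depth v → d w ≠ d v
  le : ∀ v, d v ≤ 3 * k - 2
  count : ∀ v, (if depth v = 0 then 0 else pos v + if t v ≤ pos v then 1 else 0) +
    {w | w ∈ G.children depth v ∧ pos w < t w}.ncard = d v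

theorem IsBlockForest.exists_isOrientationData (h : G.IsBlockForest k depth) (hk : 1 ≤ k) :
    ∃ pos t d, IsOrientationData G k depth pos t d := by
  classical
  -- Choices are made for all pairs, with zero data for unattainable ones, so that the recursion can
  -- be defined before its pairs are shown attainable.
  have hex : ∀ (v : V) (s : ℕ × ℕ), ∃ pos t col : V → ℕ, G.OrientableBelow k depth v s.1 s.2 →
      (∀ w ∈ G.children depth v, pos w < k - 1) ∧
      (∀ w ∈ G.children depth v, ∀ w' ∈ G.children depth v, G.Adj w w' →
        pos w ≠ pos w' ∧ t w = t w' ∧ col w ≠ col w') ∧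
      (∀ w ∈ G.children depth v, col w ≠ s.2) ∧
      s.1 + ((G.children depth v).filter fun w => pos w < t w).card = s.2 ∧
      s.2 ≤ 3 * k - 2 ∧
      ∀ w ∈ G.children depth v,
        G.OrientableBelow k depth w (pos w + if t w ≤ pos w then 1 else 0) (col w) := by
    intro v s
    by_cases hs : G.OrientableBelow k depth v s.1 s.2
    · cases hs with
      | intro pos t col h₁ h₂ h₃ h₄ h₅ h₆ =>
        exact ⟨pos, t, col, fun _ => ⟨h₁, h₂, h₃, h₄, h₅, h₆⟩⟩
    · exact ⟨0, 0, 0, fun h' => absurd h' hs⟩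
  choose Pos Tr Col hPTC using hex
  have hpar : ∀ w, ∃ v, depth w ≠ 0 → w ∈ G.children depth v := by
    intro w
    by_cases hw : depth w = 0
    · exact ⟨w, fun h' => absurd hw h'⟩
    · obtain ⟨v, hv⟩ := h.exists_parent hw
      exact ⟨v, fun _ => hv⟩
  choose par hpar using hpar
  have hpar' : ∀ {w v}, w ∈ G.children depth v → par w = v := by
    intro w v hw
    refine h.parent_unique (hpar w ?_) hw
    have := (mem_children.1 hw).2
    omega
  -- The pair (e, d) is passed down from parent to child by recursion on depth; `st n` is meaningful
  -- only at vertices of depth n.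
  let st : ℕ → V → ℕ × ℕ := fun n => Nat.rec (fun _ => (0, 0)) (fun _ s w =>
    (Pos (par w) (s (par w)) w +
      if Tr (par w) (s (par w)) w ≤ Pos (par w) (s (par w)) w then 1 else 0,
      Col (par w) (s (par w)) w)) n
  let state : V → ℕ × ℕ := fun v => st (depth v) v
  have hroot : ∀ v, depth v = 0 → state v = (0, 0) := by
    intro v hv
    simp only [state, hv]
    rfl
  have hchild : ∀ {w v}, w ∈ G.children depth v → state w = (Pos v (state v) w +
      if Tr v (state v) w ≤ Pos v (state v) w then 1 else 0, Col v (state v) w) := by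
    intro w v hw
    have hd := (mem_children.1 hw).2
    have hp := hpar' hw
    subst hp
    simp only [state, hd]
    rfl
  have hstate : ∀ n v, depth v = n → G.OrientableBelow k depth v (state v).1 (state v).2 := by
    intro n
    induction n with
    | zero =>
      intro v hv
      rw [hroot v hv]
      exact (h.orientableBelow hk v).1
    | succ n ih =>
      intro w hw
      have hwp := hpar w (by omega)
      have hd := (mem_children.1 hwp).2
      rw [hchild hwp]
      exact (hPTC _ _ (ih (par w) (by omega))).2.2.2.2.2 w hwp
  have key := fun v => hPTC v (state v) (hstate _ v rfl)
  refine ⟨fun w => Pos (par w) (state (par w)) w, fun w => Tr (par w) (state (par w)) w,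
    fun w => (state w).2, ?_, ?_, ?_, ?_, ?_⟩
  · exact fun w hw => (key (par w)).1 w (hpar w hw)
  · intro w w' hadj hd
    have hw : w ∈ G.children depth (par w) := hpar w fun h0 =>
      h.not_adj_of_depth_eq_zero hadj h0 (hd ▸ h0)
    have hw' : w' ∈ G.children depth (par w) := h.mem_children_of_adj hadj.symm hd.symm hw
    have := (key (par w)).2.1 w hw w' hw' hadj
    rw [hchild hw, hchild hw', hpar' hw']
    exact this
  · intro w v hw
    rw [hchild hw]
    exact (key v).2.2.1 w hw
  · exact fun v => (key v).2.2.2.2.1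
  · intro v
    rw [← (key v).2.2.2.1]
    congr 1
    · by_cases hv : depth v = 0
      · rw [if_pos hv, hroot v hv]
      · rw [if_neg hv, hchild (hpar v hv)]
    · rw [← Set.ncard_coe_finset]
      congr 1
      ext w
      simp only [Set.mem_ofPred_eq, Finset.coe_filter]
      refine and_congr_right fun hw => ?_
      rw [hpar' hw]

/-! ### From vertex data to a proper orientation -/

/-- The orientation encoded by vertex data. -/
def dataDigraph (G : SimpleGraph V) (depth pos t : V → ℕ) : Digraph V where
  Adj u v := G.Adj u v ∧ (depth u = depth v ∧ pos u < pos v ∨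
    depth u = depth v + 1 ∧ pos u < t u ∨ depth v = depth u + 1 ∧ t v ≤ pos v)

namespace IsOrientationData

variable {pos t d : V → ℕ} (h : G.IsBlockForest k depth)
  (hD : IsOrientationData G k depth pos t d)

include h hD

theorem isOrientation : G.IsOrientation (G.dataDigraph depth pos t) := by
  constructor
  · intro u v
    constructor
    · intro hadj
      have h₁ := h.depth_le_succ hadj
      have h₂ := h.depth_le_succ hadj.symm
      have h₃ := fun hd => (hD.sibling u v hadj hd).1
      simp only [dataDigraph, hadj, hadj.symm, true_and]
      by_cases hd : depth u = depth v
      · have := h₃ hd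
        omega
      · omega
    · rintro (h' | h')
      · exact h'.1
      · exact h'.1.symm
  · rintro u v ⟨⟨-, h₁⟩, -, h₂⟩
    omega

theorem digraphInDegree_eq (v : V) : digraphInDegree (G.dataDigraph depth pos t) v = d v := by
  classical
  -- In-neighbours are the parent, earlier siblings, or children. The first two kinds together
  -- account for e.
  have hsplit : {u | (G.dataDigraph depth pos t).Adj u v} =
      ({u | G.Adj u v ∧ depth v = depth u + 1 ∧ t v ≤ pos v} ∪
        {u | G.Adj u v ∧ depth u = depth v ∧ pos u < pos v}) ∪
      {w | w ∈ G.children depth v ∧ pos w < t w} := by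
    ext u
    simp only [dataDigraph, Set.mem_ofPred_eq, Set.mem_union, mem_children]
    tauto
  have hpar : {u | G.Adj u v ∧ depth v = depth u + 1 ∧ t v ≤ pos v}.ncard =
      if depth v = 0 then 0 else if t v ≤ pos v then 1 else 0 := by
    split_ifs with h0 ht
    · rw [Set.ncard_eq_zero]
      ext u
      simp [h0]
    · obtain ⟨p, hp⟩ := h.exists_parent h0
      rw [Set.ncard_eq_one]
      refine ⟨p, Set.ext fun u => ?_⟩
      simp only [Set.mem_ofPred_eq, Set.mem_singleton_iff, ht, and_true]
      constructor
      · rintro ⟨hadj, hd⟩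
        exact h.parent_unique (mem_children.2 ⟨hadj.symm, hd⟩) hp
      · rintro rfl
        exact ⟨(mem_children.1 hp).1.symm, (mem_children.1 hp).2⟩
    · rw [Set.ncard_eq_zero]
      ext u
      simp [ht]
  have hsib : {u | G.Adj u v ∧ depth u = depth v ∧ pos u < pos v}.ncard =
      if depth v = 0 then 0 else pos v := by
    split_ifs with h0
    · rw [Set.ncard_eq_zero]
      ext u
      simp only [Set.mem_ofPred_eq, Set.mem_empty_iff_false, iff_false]
      rintro ⟨hadj, hd, -⟩
      exact h.not_adj_of_depth_eq_zero hadj (hd.trans h0) h0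
    · have hset : {u | G.Adj u v ∧ depth u = depth v ∧ pos u < pos v} =
          ((G.siblingClass depth v).filter fun u => pos u < pos v : Finset V) := by
        ext u
        simp only [Set.mem_ofPred_eq, Finset.coe_filter, mem_siblingClass]
        constructor
        · rintro ⟨h₁, h₂, h₃⟩
          exact ⟨Or.inr ⟨h₁, h₂⟩, h₃⟩
        · rintro ⟨rfl | ⟨h₁, h₂⟩, h₃⟩
          · omega
          · exact ⟨h₁, h₂, h₃⟩
      rw [hset, Set.ncard_coe_finset]
      have hd : ∀ u ∈ G.siblingClass depth v, depth u = depth v := by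
        intro u hu
        rcases mem_siblingClass.1 hu with rfl | ⟨-, hd⟩
        · rfl
        · exact hd
      refine card_filter_lt_of_injOn (h.card_siblingClass h0)
        (fun u hu => hD.pos_lt u (by rw [hd u hu]; exact h0)) ?_ (hD.pos_lt v h0).le
      intro x hx y hy hxy
      by_contra hne
      rw [Finset.mem_coe] at hx hy
      have hxy' : x ∈ G.siblingClass depth y := by
        rwa [h.siblingClass_eq hy]
      rcases mem_siblingClass.1 hxy' with hxy' | ⟨hadj, hd⟩
      · exact hne hxy'
      · exact (hD.sibling x y hadj hd).1 hxy
  rw [digraphInDegree, hsplit, Set.ncard_union_eq, Set.ncard_union_eq, hpar, hsib, ← hD.count v]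
  · congr 1
    split_ifs <;> omega
  · rw [Set.disjoint_left]
    rintro u ⟨-, h₁, -⟩ ⟨-, h₂, -⟩
    omega
  · rw [Set.disjoint_left]
    rintro u hu ⟨hu', -⟩
    have := (mem_children.1 hu').2
    rcases hu with ⟨-, h₁, -⟩ | ⟨-, h₁, -⟩ <;> omega

theorem hasProperOrientation : G.HasProperOrientation (3 * k - 2) := by
  refine ⟨G.dataDigraph depth pos t, ⟨hD.isOrientation h, fun u v hadj => ?_⟩, fun v => ?_⟩
  · rw [hD.digraphInDegree_eq h, hD.digraphInDegree_eq h]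
    have h₁ := h.depth_le_succ hadj
    have h₂ := h.depth_le_succ hadj.symm
    rcases (show depth u = depth v ∨ depth u = depth v + 1 ∨ depth v = depth u + 1 by omega) with
      hd | hd | hd
    · exact (hD.sibling u v hadj hd).2.2
    · exact hD.parent u v (mem_children.2 ⟨hadj, hd⟩)
    · exact (hD.parent v u (mem_children.2 ⟨hadj.symm, hd⟩)).symm
  · rw [hD.digraphInDegree_eq h]
    exact hD.le v

end IsOrientationData

end

end SimpleGraph

theorem mainTheorem2 {V : Type*} [Finite V] (G : SimpleGraph V) (k : ℕ) (hk : 1 ≤ k)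
    (hG : G.IsUniformBlockGraph k) :
    G.properOrientationNumber ≤ ((3 * k - 2 : ℕ) : ℕ∞) := by
  have := Fintype.ofFinite V
  obtain ⟨pos, t, d, hD⟩ := hG.isBlockForest.exists_isOrientationData hk
  exact iInf₂_le (3 * k - 2) (hD.hasProperOrientation hG.isBlockForest)
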